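/- Let $(M,g)$ be a smooth Riemannian manifold of dimension $n$ with Levi-Civita connection $\nabla$, Ricci tensor $\mathrm{Ric}$ and scalar curvature $\mathrm{scal}$. Let $V$ be a smooth vector field which is concircular with a nonzero constant $a$, that is, $\nabla_X V=aX$ for every vector field $X$, and let $\eta=V^\flat=g(V,\cdot)$. Let $\lambda,\mu$ be smooth functions on $M$ such that $(V,\lambda,\mu)$ is an almost $\eta$-Ricci soliton, that is, $$\tfrac12\,\mathcal L_V g+\mathrm{Ric}=\lambda g+\mu\,\eta\otimes\eta .$$ (i) Then $\mathrm{Ric}=(\lambda-a)\,g+\mu\,\eta\otimes\eta$. In particular, if $n\ge 3$ and $\mathrm{Ric}$ is not identically zero, then $M$ is a quasi-Einstein manifold with associated functions $\lambda-a$ and $\mu$ and associated $1$-form $\eta$. (A non-flat Riemannian manifold of dimension at least $3$ is called quasi-Einstein with associated smooth functions $\alpha,\beta$ and $1$-form $A$ if its Ricci tensor is not identically zero and $\mathrm{Ric}=\alpha g+\beta A\otimes A$.) (ii) If $n\neq 3$, then $\mathrm{grad}\,\lambda$, $\mathrm{grad}\,\mu$ and $\mathrm{grad}(\mathrm{scal})$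 are collinear with $V$, that is, each of them is linearly dependent with $V$ at every point. More precisely, if $n\ge 2$ and $n\ne 3$, then at every point of $M$ $$\mathrm{grad}\,\lambda=2a\mu\,V,\qquad \mathrm{grad}(\mathrm{scal})=2(n-1)a\mu\,V,$$ while $\mathrm{grad}\,\mu=-\dfrac{4a\mu}{|V|^2}\,V$ wherever $V\neq0$, and $\mathrm{grad}\,\mu=0$ wherever $V=0$. -/

import Mathlib

open Bundle VectorField FiberBundle
open scoped Manifold ContDiff Topology

noncomputable section

namespace RiemGeom

variable {E : Type*} [NormedAddCommGroup E] [NormedSpace ℝ E] [FiniteDimensional ℝ E]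
  [CompleteSpace E] {H : Type*} [TopologicalSpace H] {I : ModelWithCorners ℝ E H}
  {M : Type*} [TopologicalSpace M] [ChartedSpace H M] [IsManifold I ∞ M]
  [RiemannianBundle (fun x : M => TangentSpace I x)]
  [IsContMDiffRiemannianBundle I ∞ E (fun x : M => TangentSpace I x)]

/-- The tangent spaces have finite dimension. -/
instance instFiniteDimensionalTangentSpace (x : M) : FiniteDimensional ℝ (TangentSpace I x) :=
  inferInstanceAs (FiniteDimensional ℝ E)

/-- The right-hand side of Koszul's formula, divided by two:
`½ (X⟨Y,Z⟩ + Y⟨Z,X⟩ - Z⟨X,Y⟩ - ⟨X,[Y,Z]⟩ + ⟨Y,[Z,X]⟩ + ⟨Z,[X,Y]⟩)`. -/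
def koszul (X Y Z : Π x : M, TangentSpace I x) (x : M) : ℝ :=
  (1 / 2 : ℝ) * (mvfderiv I (fun y => inner ℝ (Y y) (Z y)) x (X x)
    + mvfderiv I (fun y => inner ℝ (Z y) (X y)) x (Y x)
    - mvfderiv I (fun y => inner ℝ (X y) (Y y)) x (Z x)
    - inner ℝ (X x) (mlieBracket I Y Z x)
    + inner ℝ (Y x) (mlieBracket I Z X x)
    + inner ℝ (Z x) (mlieBracket I X Y x))

variable {X X' Y Y' Z Z' : Π x : M, TangentSpace I x} {x : M}

theorem mdifferentiableAt_inner (hX : MDiffAt (T% X) x) (hY : MDiffAt (T% Y) x) :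
    MDifferentiableAt I 𝓘(ℝ, ℝ) (fun y => (inner ℝ (X y) (Y y) : ℝ)) x :=
  MDifferentiableAt.inner_bundle (F := E) (E := fun x : M => TangentSpace I x) (b := id) hX hY

theorem koszul_tensorial_left (hY : MDiffAt (T% Y) x) (hZ : MDiffAt (T% Z) x) :
    TensorialAt I E (fun X => koszul X Y Z x) x where
  smul {f X} hf hX := by
    have e1 := mvfderiv_fun_mul hf (mdifferentiableAt_inner hZ hX)
    have e2 := mvfderiv_fun_mul hf (mdifferentiableAt_inner hX hY)
    simp only [koszul, Pi.smul_apply', inner_smul_left, inner_smul_right,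
      mlieBracket_smul_left hf hX, mlieBracket_smul_right hf hX, RCLike.conj_to_real, e1, e2]
    simp [inner_add_right, inner_smul_right, real_inner_comm]
    ring
  add {X X'} hX hX' := by
    have e1 := mvfderiv_fun_add (mdifferentiableAt_inner hZ hX) (mdifferentiableAt_inner hZ hX')
    have e2 := mvfderiv_fun_add (mdifferentiableAt_inner hX hY) (mdifferentiableAt_inner hX' hY)
    simp only [koszul, Pi.add_apply, inner_add_left, inner_add_right,
      mlieBracket_add_left hX hX', mlieBracket_add_right hX hX', e1, e2]
    simp
    ring

theorem koszul_tensorial_right (hX : MDiffAt (T% X) x) (hY : MDiffAt (T% Y) x) :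
    TensorialAt I E (fun Z => koszul X Y Z x) x where
  smul {f Z} hf hZ := by
    have e1 := mvfderiv_fun_mul hf (mdifferentiableAt_inner hY hZ)
    have e2 := mvfderiv_fun_mul hf (mdifferentiableAt_inner hZ hX)
    simp only [koszul, Pi.smul_apply', inner_smul_left, inner_smul_right,
      mlieBracket_smul_left hf hZ, mlieBracket_smul_right hf hZ, RCLike.conj_to_real, e1, e2]
    simp [inner_add_right, inner_smul_right, real_inner_comm]
    ring
  add {Z Z'} hZ hZ' := by
    have e1 := mvfderiv_fun_add (mdifferentiableAt_inner hY hZ) (mdifferentiableAt_inner hY hZ')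
    have e2 := mvfderiv_fun_add (mdifferentiableAt_inner hZ hX) (mdifferentiableAt_inner hZ' hX)
    simp only [koszul, Pi.add_apply, inner_add_left, inner_add_right,
      mlieBracket_add_left hZ hZ', mlieBracket_add_right hZ hZ', e1, e2]
    simp
    ring

theorem koszul_add_mid (hX : MDiffAt (T% X) x) (hY : MDiffAt (T% Y) x) (hY' : MDiffAt (T% Y') x)
    (hZ : MDiffAt (T% Z) x) : koszul X (Y + Y') Z x = koszul X Y Z x + koszul X Y' Z x := by
  have e1 := mvfderiv_fun_add (mdifferentiableAt_inner hY hZ) (mdifferentiableAt_inner hY' hZ)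
  have e2 := mvfderiv_fun_add (mdifferentiableAt_inner hX hY) (mdifferentiableAt_inner hX hY')
  simp only [koszul, Pi.add_apply, inner_add_left, inner_add_right,
    mlieBracket_add_left hY hY', mlieBracket_add_right hY hY', e1, e2]
  simp
  ring

theorem koszul_smul_mid {f : M → ℝ} (hf : MDiffAt f x) (hX : MDiffAt (T% X) x)
    (hY : MDiffAt (T% Y) x) (hZ : MDiffAt (T% Z) x) :
    koszul X (f • Y) Z x =
      f x * koszul X Y Z x + mvfderiv I f x (X x) * inner ℝ (Y x) (Z x) := by
  have e1 := mvfderiv_fun_mul hf (mdifferentiableAt_inner hY hZ)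
  have e2 := mvfderiv_fun_mul hf (mdifferentiableAt_inner hX hY)
  simp only [koszul, Pi.smul_apply', inner_smul_left, inner_smul_right,
    mlieBracket_smul_left hf hY, mlieBracket_smul_right hf hY, RCLike.conj_to_real, e1, e2]
  simp [inner_add_right, inner_smul_right, real_inner_comm]
  ring

open Classical in
/-- For a vector field `Y` differentiable at `x`, the bilinear form `(u, w) ↦ ⟨∇_u Y, w⟩` on the
tangent space at `x` given by Koszul's formula (and `0` if `Y` is not differentiable at `x`). -/
def koszulForm (Y : Π x : M, TangentSpace I x) (x : M) :
    TangentSpace I x →L[ℝ] TangentSpace I x →L[ℝ] ℝ :=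
  if hY : MDiffAt (T% Y) x then
    TensorialAt.mkHom₂ (fun X Z => koszul X Y Z x) x
      (fun _ hZ => koszul_tensorial_left hY hZ) (fun _ hX => koszul_tensorial_right hX hY)
  else 0

theorem koszulForm_apply (hX : MDiffAt (T% X) x) (hY : MDiffAt (T% Y) x) (hZ : MDiffAt (T% Z) x) :
    koszulForm Y x (X x) (Z x) = koszul X Y Z x := by
  rw [koszulForm, dif_pos hY]
  exact TensorialAt.mkHom₂_apply _ _ hX hZ

/-- `∇_u Y` at `x`: the vector representing `w ↦ koszulForm Y x u w`. -/
def leviCivitaFun (Y : Π x : M, TangentSpace I x) (x : M) :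
    TangentSpace I x →L[ℝ] TangentSpace I x :=
  haveI : CompleteSpace (TangentSpace I x) := FiniteDimensional.complete ℝ _
  (InnerProductSpace.toDual ℝ (TangentSpace I x)).symm.toContinuousLinearEquiv.toContinuousLinearMap
    ∘L koszulForm Y x

theorem inner_leviCivitaFun (Y : Π x : M, TangentSpace I x) (x : M) (u w : TangentSpace I x) :
    inner ℝ (leviCivitaFun Y x u) w = koszulForm Y x u w := by
  have : CompleteSpace (TangentSpace I x) := FiniteDimensional.complete ℝ _
  exact InnerProductSpace.toDual_symm_apply

variable (I M) in
/-- The Levi-Civita connection `∇`; the vector `∇_u Y` at `x` is `leviCivita I M Y x u`. -/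
def leviCivita : CovariantDerivative I E (fun x : M => TangentSpace I x) where
  toFun := leviCivitaFun
  isCovariantDerivativeOnUniv :=
    { add := by
        intro Y Y' x hY hY' _
        ext u
        refine ext_inner_right ℝ fun w => ?_
        have hu := mdifferentiableAt_extend I E u
        have hw := mdifferentiableAt_extend I E w
        have h1 := koszulForm_apply hu (mdifferentiableAt_add_section hY hY') hw
        have h2 := koszulForm_apply hu hY hw
        have h3 := koszulForm_apply hu hY' hw
        simp only [extend_apply_self] at h1 h2 h3
        rw [add_apply, inner_add_left]
        simp only [inner_leviCivitaFun]
        rw [h2, h3, ← koszul_add_mid hu hY hY' hw]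
        exact h1
      leibniz := by
        intro Y f x hY hf _
        ext u
        refine ext_inner_right ℝ fun w => ?_
        have hu := mdifferentiableAt_extend I E u
        have hw := mdifferentiableAt_extend I E w
        have h1 := koszulForm_apply hu (hf.smul_section hY) hw
        have h2 := koszulForm_apply hu hY hw
        have h3 := koszul_smul_mid hf hu hY hw
        simp only [extend_apply_self] at h1 h2 h3
        simp only [add_apply, smul_apply,
          ContinuousLinearMap.smulRight_apply, inner_add_left, inner_smul_left,
          inner_leviCivitaFun, RCLike.conj_to_real]
        rw [h2, ← h3]
        exact h1 }

theorem inner_leviCivita (hX : MDiffAt (T% X) x) (hY : MDiffAt (T% Y) x) (hZ : MDiffAt (T% Z) x) :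
    inner ℝ (leviCivita I M Y x (X x)) (Z x) = koszul X Y Z x :=
  (inner_leviCivitaFun _ _ _ _).trans (koszulForm_apply hX hY hZ)

/-- The Levi-Civita connection is torsion-free. -/
theorem leviCivita_torsion : (leviCivita I M).torsion = 0 := by
  rw [CovariantDerivative.torsion_eq_zero_iff]
  intro X Y x hX hY
  refine ext_inner_right ℝ fun w => ?_
  have hw := mdifferentiableAt_extend I E w
  have h1 := inner_leviCivita hX hY hw
  have h2 := inner_leviCivita hY hX hw
  simp only [extend_apply_self] at h1 h2
  rw [inner_sub_left, h1, h2]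
  simp only [koszul, extend_apply_self, mlieBracket_swap_apply (V := Y) (W := X),
    mlieBracket_swap_apply (V := X) (W := extend E w),
    mlieBracket_swap_apply (V := Y) (W := extend E w), inner_neg_right]
  simp only [real_inner_comm]
  ring

/-- The Levi-Civita connection is compatible with the metric. -/
theorem leviCivita_metric (hX : MDiffAt (T% X) x) (hY : MDiffAt (T% Y) x) (hZ : MDiffAt (T% Z) x) :
    mvfderiv I (fun y => (inner ℝ (Y y) (Z y) : ℝ)) x (X x) =
      inner ℝ (leviCivita I M Y x (X x)) (Z x) + inner ℝ (Y x) (leviCivita I M Z x (X x)) := by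
  have h1 := inner_leviCivita hX hY hZ
  have h2 := inner_leviCivita hX hZ hY
  rw [real_inner_comm _ (Y x), h1, h2]
  simp only [koszul, mlieBracket_swap_apply (V := X) (W := Z),
    mlieBracket_swap_apply (V := Z) (W := Y), mlieBracket_swap_apply (V := Y) (W := X),
    inner_neg_right]
  simp only [real_inner_comm]
  ring

/-- The curvature `R(X, Y)Z = ∇_X ∇_Y Z - ∇_Y ∇_X Z - ∇_[X,Y] Z` of vector fields. -/
def curvature (X Y Z : Π x : M, TangentSpace I x) (x : M) : TangentSpace I x :=
  leviCivita I M (fun y => leviCivita I M Z y (Y y)) x (X x)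
    - leviCivita I M (fun y => leviCivita I M Z y (X y)) x (Y x)
    - leviCivita I M Z x (mlieBracket I X Y x)

/-- The curvature tensor `R(u, v)w` at `x`. As `R` is a tensor, its value is computed on any vector
fields smooth near `x` that extend `u`, `v`, `w`. -/
def riemann (x : M) (u v w : TangentSpace I x) : TangentSpace I x :=
  curvature (extend E u) (extend E v) (extend E w) x

/-- The Ricci tensor `Ric(v, w) = trace (u ↦ R(u, v)w)` at `x`, the trace being taken in an
orthonormal basis of the tangent space. -/
def ric (x : M) (v w : TangentSpace I x) : ℝ :=
  ∑ i, inner ℝ (riemann x (stdOrthonormalBasis ℝ (TangentSpace I x) i) v w)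
    (stdOrthonormalBasis ℝ (TangentSpace I x) i)

variable (I) in
/-- The scalar curvature, the trace of the Ricci tensor with respect to the metric. -/
def scal (x : M) : ℝ :=
  ∑ i, ric x (stdOrthonormalBasis ℝ (TangentSpace I x) i)
    (stdOrthonormalBasis ℝ (TangentSpace I x) i)

variable (I) in
/-- The gradient of `f`: `⟨grad f, u⟩ = df(u)`. -/
def grad (f : M → ℝ) (x : M) : TangentSpace I x :=
  haveI : CompleteSpace (TangentSpace I x) := FiniteDimensional.complete ℝ _
  (InnerProductSpace.toDual ℝ (TangentSpace I x)).symm (mvfderiv I f x)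

/-- The Lie derivative of the metric at `x`,
`(L_V g)(X, Y) = V⟨X, Y⟩ - ⟨[V, X], Y⟩ - ⟨X, [V, Y]⟩`, computed on vector fields smooth near `x`
that extend `u` and `v` (it is a tensor in `X`, `Y`). -/
def lieDerivMetric (V : Π x : M, TangentSpace I x) (x : M) (u v : TangentSpace I x) : ℝ :=
  mvfderiv I (fun y => (inner ℝ (extend E u y) (extend E v y) : ℝ)) x (V x)
    - inner ℝ (mlieBracket I V (extend E u) x) v
    - inner ℝ u (mlieBracket I V (extend E v) x)

/-- The 1-form `V♭ = ⟨V, ·⟩` dual to a vector field. -/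
def flat (V : Π x : M, TangentSpace I x) (x : M) : TangentSpace I x →L[ℝ] ℝ :=
  innerSL ℝ (V x)

/-- Smooth vector fields. -/
def IsSmoothField (V : Π x : M, TangentSpace I x) : Prop :=
  ContMDiff I I.tangent ∞ (fun x => (⟨x, V x⟩ : TangentBundle I M))

/-- Smooth 1-forms. -/
def IsSmoothForm (A : Π x : M, TangentSpace I x →L[ℝ] ℝ) : Prop :=
  ContMDiff I (I.prod 𝓘(ℝ, E →L[ℝ] ℝ)) ∞
    (fun x => TotalSpace.mk' (E →L[ℝ] ℝ) (E := fun x : M => TangentSpace I x →L[ℝ] ℝ) x (A x))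

/-- `V` is concircular with function `a`: `∇_u V = a u` for all tangent vectors `u`. -/
structure IsConcircular (V : Π x : M, TangentSpace I x) (a : M → ℝ) : Prop where
  smooth_field : IsSmoothField V
  smooth_fun : ContMDiff I 𝓘(ℝ, ℝ) ∞ a
  cov_eq : ∀ (x : M) (u : TangentSpace I x), leviCivita I M V x u = a x • u

/-- `(V, lam, mu)` is an almost `η`-Ricci soliton:
`½ L_V g + Ric = lam g + mu η ⊗ η` with smooth functions `lam`, `mu`. -/
structure IsAlmostEtaRicciSoliton (V : Π x : M, TangentSpace I x) (lam mu : M → ℝ)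
    (η : Π x : M, TangentSpace I x →L[ℝ] ℝ) : Prop where
  smooth_field : IsSmoothField V
  smooth_lam : ContMDiff I 𝓘(ℝ, ℝ) ∞ lam
  smooth_mu : ContMDiff I 𝓘(ℝ, ℝ) ∞ mu
  smooth_form : IsSmoothForm η
  soliton_eq : ∀ (x : M) (u v : TangentSpace I x),
    1 / 2 * lieDerivMetric V x u v + ric x u v = lam x * inner ℝ u v + mu x * (η x u * η x v)

/-- `M` is quasi-Einstein with associated functions `α`, `β` and 1-form `A`: `M` is non-flat of
dimension at least `3`, its Ricci tensor is not identically zero, and `Ric = α g + β A ⊗ A`. -/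
structure IsQuasiEinstein (α β : M → ℝ) (A : Π x : M, TangentSpace I x →L[ℝ] ℝ) : Prop where
  three_le_dim : 3 ≤ Module.finrank ℝ E
  non_flat : ∃ (x : M) (u v w : TangentSpace I x), riemann x u v w ≠ 0
  ric_ne_zero : ∃ (x : M) (u v : TangentSpace I x), ric x u v ≠ 0
  smooth_alpha : ContMDiff I 𝓘(ℝ, ℝ) ∞ α
  smooth_beta : ContMDiff I 𝓘(ℝ, ℝ) ∞ β
  smooth_form : IsSmoothForm A
  ric_eq : ∀ (x : M) (u v : TangentSpace I x),
    ric x u v = α x * inner ℝ u v + β x * (A x u * A x v)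

/-- Two vector fields are collinear: they are linearly dependent at every point. -/
def AreCollinear (W V : Π x : M, TangentSpace I x) : Prop :=
  ∀ x : M, ∃ s t : ℝ, (s ≠ 0 ∨ t ≠ 0) ∧ s • W x + t • V x = 0

end RiemGeom

end

open Bundle VectorField FiberBundle
open scoped Manifold ContDiff Topology

set_option linter.unusedSectionVars false

noncomputable section

namespace RiemGeom

variable {E : Type*} [NormedAddCommGroup E] [NormedSpace ℝ E] [FiniteDimensional ℝ E]
  [CompleteSpace E] {H : Type*} [TopologicalSpace H] {I : ModelWithCorners ℝ E H}
  {M : Type*} [TopologicalSpace M] [ChartedSpace H M] [IsManifold I ∞ M]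
  [RiemannianBundle (fun x : M => TangentSpace I x)]
  [IsContMDiffRiemannianBundle I ∞ E (fun x : M => TangentSpace I x)]

/-! ### Smooth functions and fields, Lie brackets as commutators of derivations -/

section

/-! Since `∇V = a·id`, `L_V g = 2a g`, and the soliton equation becomes the quasi-Einstein equation.

For the gradients, write `f = |V|²`. The curvature kills `V`, because `R(X,Y)V = a(∇_X Y - ∇_Y X -
[X,Y]) = 0`. Hence `Ric(V,V) = 0`, which gives `λ - a + μf = 0` off the zeros of `V`. The zero set
has empty interior as `a ≠ 0`, so the relation holds everywhere (`lam_sub`), and differentiating it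
gives `dλ = -f dμ - 2aμη` (`mvfderiv_lam`).

A second relation comes from inserting the quasi-Einstein form into `d scal = 2 div Ric`
(`sum_nablaRic`): `(n-2)dλ + f dμ = (2dμ(V) + 2naμ)η` (`contracted_bianchi`). Evaluating both on `V`
gives `dμ(V) = -4aμ` after division by `(n-1)f`; eliminating `f dμ` then gives `(n-3)dλ =
2(n-3)aμη`. This is where `n ≠ 3` enters. The formulas for `grad μ` off the zeros of `V` and for
`scal = (n-1)(λ-a)` follow.

At a zero of `V` the relation `f dμ = -4aμη` is empty, and the commutator `[u,V] = a u` is used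
instead (`mvfderiv_mu_of_eq_zero`).

Most of the file builds the tensor calculus behind this: tensoriality of the curvature, smooth
orthonormal frames and the Bianchi identities. -/

theorem mvfderiv_congr {f g : M → ℝ} {x : M} (h : f =ᶠ[𝓝 x] g) :
    mvfderiv I f x = mvfderiv I g x := by
  ext v
  change mfderiv% f x v = mfderiv% g x v
  rw [h.mfderiv_eq]
  rfl

variable {f : M → ℝ} {X Y Z W : Π x : M, TangentSpace I x} {x : M}

theorem smoothAt_mvfderiv (hf : CMDiffAt ∞ f x) (hX : CMDiffAt ∞ (T% X) x) :
    CMDiffAt ∞ (fun y => mvfderiv I f y (X y)) x := by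
  have h1 := hf.mfderiv_const (m := ∞) (by simp)
  have h2 := ContMDiffAt.clm_apply_of_inCoordinates (n := ∞) (IM := I) (IB₁ := I) (IB₂ := 𝓘(ℝ, ℝ))
    (E₁ := fun x : M => TangentSpace I x) (E₂ := fun x : ℝ => TangentSpace 𝓘(ℝ, ℝ) x)
    (b₁ := id) (b₂ := f) (v := X) (ϕ := fun y => mfderiv% f y) h1 hX hf
  exact (contMDiff_snd_tangentBundle_modelSpace ℝ 𝓘(ℝ, ℝ)).contMDiffAt.comp x h2

theorem mdiffAt_of_smoothAt (hX : CMDiffAt ∞ (T% X) x) : MDiffAt (T% X) x :=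
  hX.mdifferentiableAt (by simp)

theorem eventually_mdiffAt_of_smoothAt (hX : CMDiffAt ∞ (T% X) x) :
    ∀ᶠ y in 𝓝 x, MDiffAt (T% X) y := by
  -- Smoothness of order `∞` at a point does not spread to a neighbourhood, as the neighbourhood may
  -- shrink with the order; order `1` does spread.
  have : CMDiffAt 1 (T% X) x := hX.of_le (by exact_mod_cast le_top)
  filter_upwards [(contMDiffAt_iff_contMDiffAt_nhds (by decide)).1 this] with y hy
  exact hy.mdifferentiableAt (by simp)

theorem eventually_mdiffAt_fun_of_smoothAt (hf : CMDiffAt ∞ f x) :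
    ∀ᶠ y in 𝓝 x, MDiffAt f y := by
  have : CMDiffAt 1 f x := hf.of_le (by exact_mod_cast le_top)
  filter_upwards [(contMDiffAt_iff_contMDiffAt_nhds (by decide)).1 this] with y hy
  exact hy.mdifferentiableAt (by simp)

theorem smoothAt_mlieBracket (hX : CMDiffAt ∞ (T% X) x) (hY : CMDiffAt ∞ (T% Y) x) :
    CMDiffAt ∞ (T% (mlieBracket I X Y)) x := by
  have : IsManifold I ((⊤ : ℕ∞) + 1 : WithTop ℕ∞) M := by
    simpa using ‹IsManifold I ∞ M›
  have : IsManifold I (minSmoothness ℝ 2) M := by simpa using (inferInstance : IsManifold I 2 M)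
  exact ContMDiffAt.mlieBracket_vectorField (m := ⊤) (n := ⊤) hX hY (by simp)

theorem mlieBracket_jacobi (hX : CMDiffAt ∞ (T% X) x) (hY : CMDiffAt ∞ (T% Y) x)
    (hZ : CMDiffAt ∞ (T% Z) x) :
    mlieBracket I X (mlieBracket I Y Z) x =
      mlieBracket I (mlieBracket I X Y) Z x + mlieBracket I Y (mlieBracket I X Z) x := by
  have : IsManifold I (minSmoothness ℝ 3) M := by simpa using (inferInstance : IsManifold I 3 M)
  have h2 : (minSmoothness ℝ 2) ≤ ∞ := by simpa using ENat.LEInfty.out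
  exact leibniz_identity_mlieBracket_apply (hX.of_le h2) (hY.of_le h2) (hZ.of_le h2)

theorem smoothAt_inner (hX : CMDiffAt ∞ (T% X) x) (hY : CMDiffAt ∞ (T% Y) x) :
    CMDiffAt ∞ (fun y => (inner ℝ (X y) (Y y) : ℝ)) x :=
  ContMDiffAt.inner_bundle (F := E) (E := fun x : M => TangentSpace I x) (b := id) hX hY

/-- Inserted in the Jacobi identity for `X`, `Y`, `f • Z`, this expansion exposes the second
derivatives of `f` as coefficients of `Z`. -/
theorem mlieBracket_mlieBracket_smul (hf : CMDiffAt ∞ f x) (hY : CMDiffAt ∞ (T% Y) x)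
    (hZ : CMDiffAt ∞ (T% Z) x) :
    mlieBracket I X (mlieBracket I Y (f • Z)) x =
      mvfderiv I (fun y => mvfderiv I f y (Y y)) x (X x) • Z x
        + mvfderiv I f x (Y x) • mlieBracket I X Z x
        + mvfderiv I f x (X x) • mlieBracket I Y Z x
        + f x • mlieBracket I X (mlieBracket I Y Z) x := by
  have hev : mlieBracket I Y (f • Z) =ᶠ[𝓝 x]
      (fun y => mvfderiv I f y (Y y)) • Z + f • mlieBracket I Y Z := by
    filter_upwards [eventually_mdiffAt_fun_of_smoothAt hf, eventually_mdiffAt_of_smoothAt hZ]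
      with y h1 h2
    exact mlieBracket_smul_right h1 h2
  have hYf := smoothAt_mvfderiv hf hY
  have hYZ := smoothAt_mlieBracket hY hZ
  rw [Filter.EventuallyEq.rfl.mlieBracket_vectorField_eq hev,
    mlieBracket_add_right (mdiffAt_of_smoothAt (hYf.smul_section hZ))
      (mdiffAt_of_smoothAt (hf.smul_section hYZ)),
    mlieBracket_smul_right (hYf.mdifferentiableAt (by simp)) (mdiffAt_of_smoothAt hZ),
    mlieBracket_smul_right (hf.mdifferentiableAt (by simp)) (mdiffAt_of_smoothAt hYZ)]
  abel

/-- The Lie bracket acts on functions as the commutator of derivations. -/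
theorem mvfderiv_mlieBracket
    (hf : CMDiffAt ∞ f x) (hX : CMDiffAt ∞ (T% X) x) (hY : CMDiffAt ∞ (T% Y) x) :
    mvfderiv I f x (mlieBracket I X Y x) =
      mvfderiv I (fun y => mvfderiv I f y (Y y)) x (X x)
        - mvfderiv I (fun y => mvfderiv I f y (X y)) x (Y x) := by
  by_cases hE : ∀ w : TangentSpace I x, w = 0
  · rw [hE (mlieBracket I X Y x), hE (X x), hE (Y x)]
    simp
  push Not at hE
  obtain ⟨w, hw⟩ := hE
  have hZ : CMDiffAt ∞ (T% (extend E w)) x := contMDiffAt_extend I E w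
  have hJ := mlieBracket_jacobi hX hY (hf.smul_section hZ)
  have hJ' := mlieBracket_jacobi hX hY hZ
  rw [mlieBracket_mlieBracket_smul hf hY hZ, mlieBracket_mlieBracket_smul hf hX hZ,
    mlieBracket_smul_right (hf.mdifferentiableAt (by simp)) (mdiffAt_of_smoothAt hZ), hJ',
    extend_apply_self] at hJ
  -- The Jacobi identity for `Z` removes the terms in `f x`, and the terms with one derivative of
  -- `f` agree on both sides; only a multiple of `w` is left, and `w ≠ 0`.
  have key : (mvfderiv I f x (mlieBracket I X Y x) -
      (mvfderiv I (fun y => mvfderiv I f y (Y y)) x (X x)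
        - mvfderiv I (fun y => mvfderiv I f y (X y)) x (Y x))) • w = 0 := by
    rw [← sub_eq_zero.2 hJ.symm]
    module
  rcases smul_eq_zero.1 key with h | h
  · linarith
  · exact absurd h hw

end

/-! ### Smooth orthonormal frames and smoothness of covariant derivatives -/

section

variable {f : M → ℝ} {X Y Z W : Π x : M, TangentSpace I x} {x : M}

/-- Each step of the recursion divides only by `⟨G j, G j⟩`, nonzero at `x` by linear independence
there. -/
theorem smoothAt_gramSchmidt {n : ℕ} {s : Fin n → Π x : M, TangentSpace I x}
    (hs : ∀ i, CMDiffAt ∞ (T% (s i)) x) (hli : LinearIndependent ℝ (fun i => s i x)) (i : Fin n) :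
    CMDiffAt ∞ (T% (fun y => InnerProductSpace.gramSchmidt ℝ (fun j => s j y) i)) x := by
  let G : Fin n → Π x : M, TangentSpace I x :=
    fun i y => InnerProductSpace.gramSchmidt ℝ (fun j => s j y) i
  change CMDiffAt ∞ (T% (G i)) x
  induction i using WellFoundedLT.induction with
  | _ i ih =>
    have hsum : CMDiffAt ∞ (T% (s i - fun y => ∑ j ∈ Finset.Iio i,
        ((fun y => (inner ℝ (G j y) (s i y) : ℝ) / inner ℝ (G j y) (G j y)) • G j) y)) x := by
      refine (hs i).sub_section (ContMDiffAt.sum_section fun j hj => ?_)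
      have hj' := ih j (Finset.mem_Iio.1 hj)
      refine ContMDiffAt.smul_section ?_ hj'
      refine (smoothAt_inner hj' (hs i)).div₀ (smoothAt_inner hj' hj') ?_
      exact inner_self_ne_zero.2 (InnerProductSpace.gramSchmidt_ne_zero j hli)
    refine hsum.congr_of_eventuallyEq (.of_forall fun y => ?_)
    simp only [TotalSpace.mk_inj, G]
    rw [InnerProductSpace.gramSchmidt_def]
    simp [Submodule.starProjection_singleton]

theorem smoothAt_normalize (hX : CMDiffAt ∞ (T% X) x) (h0 : X x ≠ 0) :
    CMDiffAt ∞ (T% (fun y => ‖X y‖⁻¹ • X y)) x := by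
  have h1 : CMDiffAt ∞ (fun y => ‖X y‖⁻¹) x := by
    have h2 : (inner ℝ (X x) (X x) : ℝ) ≠ 0 := inner_self_ne_zero.2 h0
    have h3 : CMDiffAt ∞ (fun y => Real.sqrt (inner ℝ (X y) (X y))) x :=
      (Real.contDiffAt_sqrt h2).contMDiffAt.comp x (smoothAt_inner hX hX)
    simp only [norm_eq_sqrt_real_inner]
    exact h3.inv₀ (Real.sqrt_ne_zero'.2 (real_inner_self_pos.2 h0))
  exact h1.smul_section hX

/-- A frame of vector fields, smooth and orthonormal in a neighbourhood of `x`. -/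
structure IsOrthonormalFrameAt (e : Fin (Module.finrank ℝ E) → Π x : M, TangentSpace I x)
    (x : M) : Prop where
  smooth : ∀ᶠ y in 𝓝 x, ∀ i, CMDiffAt ∞ (T% (e i)) y
  orthonormal : ∀ᶠ y in 𝓝 x, Orthonormal ℝ (fun i => e i y)

theorem exists_isOrthonormalFrameAt (x : M) :
    ∃ e : Fin (Module.finrank ℝ E) → Π x : M, TangentSpace I x, IsOrthonormalFrameAt e x := by
  let t := trivializationAt E (fun x : M => TangentSpace I x) x
  let b := Module.finBasis ℝ E
  have hf := t.isLocalFrameOn_localFrame_baseSet I ∞ b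
  have hx : t.baseSet ∈ 𝓝 x := t.open_baseSet.mem_nhds (FiberBundle.mem_baseSet_trivializationAt' x)
  refine ⟨fun i y => InnerProductSpace.gramSchmidtNormed ℝ (fun j => t.localFrame b j y) i, ?_, ?_⟩
  · filter_upwards [hx] with y hy i
    exact smoothAt_normalize
      (smoothAt_gramSchmidt (fun j => hf.contMDiffAt t.open_baseSet hy j)
        (hf.linearIndependent hy) i)
      (InnerProductSpace.gramSchmidt_ne_zero i (hf.linearIndependent hy))
  · filter_upwards [hx] with y hy
    exact InnerProductSpace.gramSchmidtNormed_orthonormal (hf.linearIndependent hy)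

/-- An orthonormal family of `dim M` tangent vectors, as an orthonormal basis. -/
def tangentOrthonormalBasis {v : Fin (Module.finrank ℝ E) → TangentSpace I x}
    (hv : Orthonormal ℝ v) :
    OrthonormalBasis (Fin (Module.finrank ℝ E)) ℝ (TangentSpace I x) :=
  OrthonormalBasis.mk hv (by
    have h : Fintype.card (Fin (Module.finrank ℝ E)) = Module.finrank ℝ (TangentSpace I x) :=
      Fintype.card_fin _
    rw [hv.linearIndependent.span_eq_top_of_card_eq_finrank' h])

theorem tangentOrthonormalBasis_apply {v : Fin (Module.finrank ℝ E) → TangentSpace I x}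
    (hv : Orthonormal ℝ v) (i : Fin (Module.finrank ℝ E)) :
    tangentOrthonormalBasis hv i = v i := by
  simp [tangentOrthonormalBasis]

theorem sum_inner_smul {v : Fin (Module.finrank ℝ E) → TangentSpace I x}
    (hv : Orthonormal ℝ v) (w : TangentSpace I x) : ∑ i, (inner ℝ (v i) w : ℝ) • v i = w := by
  simpa [tangentOrthonormalBasis_apply] using (tangentOrthonormalBasis hv).sum_repr' w

theorem smoothAt_koszul (hX : CMDiffAt ∞ (T% X) x) (hY : CMDiffAt ∞ (T% Y) x)
    (hZ : CMDiffAt ∞ (T% Z) x) : CMDiffAt ∞ (fun y => koszul X Y Z y) x := by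
  unfold koszul
  refine ContMDiffAt.mul contMDiffAt_const ?_
  exact (((((smoothAt_mvfderiv (smoothAt_inner hY hZ) hX).add
    (smoothAt_mvfderiv (smoothAt_inner hZ hX) hY)).sub
    (smoothAt_mvfderiv (smoothAt_inner hX hY) hZ)).sub
    (smoothAt_inner hX (smoothAt_mlieBracket hY hZ))).add
    (smoothAt_inner hY (smoothAt_mlieBracket hZ hX))).add
    (smoothAt_inner hZ (smoothAt_mlieBracket hX hY))

/-- The covariant derivative of a smooth field along a smooth field is smooth. -/
theorem smoothAt_leviCivita (hX : CMDiffAt ∞ (T% X) x) (hY : CMDiffAt ∞ (T% Y) x) :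
    CMDiffAt ∞ (T% (fun y => leviCivita I M Y y (X y))) x := by
  obtain ⟨e, he⟩ := exists_isOrthonormalFrameAt (I := I) x
  have hes := he.smooth.self_of_nhds
  have h1 : CMDiffAt ∞ (T% (fun y => ∑ i, ((fun y => koszul X Y (e i) y) • e i) y)) x :=
    ContMDiffAt.sum_section fun i _ => (smoothAt_koszul hX hY (hes i)).smul_section (hes i)
  refine h1.congr_of_eventuallyEq ?_
  filter_upwards [he.orthonormal, eventually_mdiffAt_of_smoothAt hX,
    eventually_mdiffAt_of_smoothAt hY,
    Filter.eventually_all.2 fun i => eventually_mdiffAt_of_smoothAt (hes i)] with y ho hXy hYy hey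
  simp only [TotalSpace.mk_inj]
  rw [← sum_inner_smul ho (leviCivita I M Y y (X y))]
  refine Finset.sum_congr rfl fun i _ => ?_
  simp only [Pi.smul_apply']
  rw [← inner_leviCivita hXy hYy (hey i), real_inner_comm]

/-- `TensorialAt` tests against fields that are merely differentiable, so `X` cannot be assumed
smooth here. Expanding `X` in a smooth frame moves its low regularity into scalar coefficients. -/
theorem mdiffAt_leviCivita (hX : MDiffAt (T% X) x) (hY : CMDiffAt ∞ (T% Y) x) :
    MDiffAt (T% (fun y => leviCivita I M Y y (X y))) x := by
  obtain ⟨e, he⟩ := exists_isOrthonormalFrameAt (I := I) x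
  have hes := he.smooth.self_of_nhds
  have h1 : MDiffAt (T% (fun y => ∑ i, ((fun y => (inner ℝ (e i y) (X y) : ℝ)) •
      fun y => leviCivita I M Y y (e i y)) y)) x :=
    MDifferentiableAt.sum_section fun i _ =>
      (mdifferentiableAt_inner (mdiffAt_of_smoothAt (hes i)) hX).smul_section
        (mdiffAt_of_smoothAt (smoothAt_leviCivita (hes i) hY))
  refine h1.congr_of_eventuallyEq ?_
  filter_upwards [he.orthonormal] with y ho
  simp only [TotalSpace.mk_inj]
  conv_lhs => rw [← sum_inner_smul ho (X y)]
  simp [map_sum]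

end

/-! ### Calculus of the connection, tensoriality of the curvature, traces -/

section

variable {f : M → ℝ} {X X' Y Z Z' W : Π x : M, TangentSpace I x} {x : M}

/-- The covariant derivative `∇_X Y` of vector fields. -/
def nabla (X Y : Π x : M, TangentSpace I x) (x : M) : TangentSpace I x :=
  leviCivita I M Y x (X x)

theorem nabla_add_left : nabla (X + X') Y x = nabla X Y x + nabla X' Y x := by
  simp [nabla]

theorem nabla_smul_left : nabla (f • X) Y x = f x • nabla X Y x := by
  simp [nabla]

theorem nabla_add_right (hY : MDiffAt (T% Y) x) (hZ : MDiffAt (T% Z) x) :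
    nabla X (Y + Z) x = nabla X Y x + nabla X Z x := by
  simp [nabla, (leviCivita I M).isCovariantDerivativeOnUniv.add hY hZ]

theorem nabla_smul_right (hf : MDiffAt f x) (hY : MDiffAt (T% Y) x) :
    nabla X (f • Y) x = f x • nabla X Y x + mvfderiv I f x (X x) • Y x := by
  simp [nabla, (leviCivita I M).isCovariantDerivativeOnUniv.leibniz hY hf]

theorem nabla_const_smul_right (c : ℝ) (hY : MDiffAt (T% Y) x) :
    nabla X (c • Y) x = c • nabla X Y x := by
  simp [nabla, (leviCivita I M).isCovariantDerivativeOnUniv.smul_const c hY]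

theorem nabla_sub_right (hY : MDiffAt (T% Y) x) (hZ : MDiffAt (T% Z) x) :
    nabla X (Y - Z) x = nabla X Y x - nabla X Z x := by
  have h : Y - Z = Y + (-1 : ℝ) • Z := by
    funext y
    simp [sub_eq_add_neg]
  have hZ' : MDiffAt (T% ((-1 : ℝ) • Z)) x :=
    MDifferentiableAt.smul_section (f := fun _ => (-1 : ℝ)) mdifferentiableAt_const hZ
  rw [h, nabla_add_right hY hZ', nabla_const_smul_right _ hZ]
  simp [sub_eq_add_neg]

theorem nabla_congr_right (hY : MDiffAt (T% Y) x) (hZ : MDiffAt (T% Z) x) (h : Y =ᶠ[𝓝 x] Z) :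
    nabla X Y x = nabla X Z x := by
  unfold nabla
  congr 1
  exact (leviCivita I M).isCovariantDerivativeOnUniv.congr_of_eventuallyEq hY hZ
    Filter.univ_mem h

theorem nabla_sub_nabla (hX : MDiffAt (T% X) x) (hY : MDiffAt (T% Y) x) :
    nabla X Y x - nabla Y X x = mlieBracket I X Y x :=
  (CovariantDerivative.torsion_eq_zero_iff _).1 leviCivita_torsion hX hY

theorem mvfderiv_inner (hX : MDiffAt (T% X) x) (hY : MDiffAt (T% Y) x) (hZ : MDiffAt (T% Z) x) :
    mvfderiv I (fun y => (inner ℝ (Y y) (Z y) : ℝ)) x (X x) =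
      inner ℝ (nabla X Y x) (Z x) + inner ℝ (Y x) (nabla X Z x) :=
  leviCivita_metric hX hY hZ

theorem smoothAt_nabla (hX : CMDiffAt ∞ (T% X) x) (hY : CMDiffAt ∞ (T% Y) x) :
    CMDiffAt ∞ (T% (nabla X Y)) x :=
  smoothAt_leviCivita hX hY

theorem curvature_eq_nabla : curvature X Y Z =
    nabla X (nabla Y Z) - nabla Y (nabla X Z) - nabla (mlieBracket I X Y) Z := rfl

theorem smoothAt_curvature (hX : CMDiffAt ∞ (T% X) x) (hY : CMDiffAt ∞ (T% Y) x)
    (hZ : CMDiffAt ∞ (T% Z) x) : CMDiffAt ∞ (T% (curvature X Y Z)) x := by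
  rw [curvature_eq_nabla]
  exact ((smoothAt_nabla hX (smoothAt_nabla hY hZ)).sub_section
    (smoothAt_nabla hY (smoothAt_nabla hX hZ))).sub_section
    (smoothAt_nabla (smoothAt_mlieBracket hX hY) hZ)

theorem curvature_swap : curvature X Y Z x = -curvature Y X Z x := by
  simp only [curvature, mlieBracket_swap_apply (V := X) (W := Y), map_neg]
  abel

theorem mvfderiv_mvfderiv_inner (hX : CMDiffAt ∞ (T% X) x) (hY : CMDiffAt ∞ (T% Y) x)
    (hZ : CMDiffAt ∞ (T% Z) x) (hW : CMDiffAt ∞ (T% W) x) :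
    mvfderiv I (fun y => mvfderiv I (fun z => (inner ℝ (Z z) (W z) : ℝ)) y (Y y)) x (X x) =
      inner ℝ (nabla X (nabla Y Z) x) (W x) + inner ℝ (nabla Y Z x) (nabla X W x)
        + inner ℝ (nabla X Z x) (nabla Y W x) + inner ℝ (Z x) (nabla X (nabla Y W) x) := by
  have hev : (fun y => mvfderiv I (fun z => (inner ℝ (Z z) (W z) : ℝ)) y (Y y)) =ᶠ[𝓝 x]
      fun y => inner ℝ (nabla Y Z y) (W y) + inner ℝ (Z y) (nabla Y W y) := by
    filter_upwards [eventually_mdiffAt_of_smoothAt hY, eventually_mdiffAt_of_smoothAt hZ,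
      eventually_mdiffAt_of_smoothAt hW] with y h1 h2 h3
    exact mvfderiv_inner h1 h2 h3
  have hYZ := smoothAt_nabla hY hZ
  have hYW := smoothAt_nabla hY hW
  have d {A : Π x : M, TangentSpace I x} (hA : CMDiffAt ∞ (T% A) x) := mdiffAt_of_smoothAt hA
  rw [mvfderiv_congr hev, mvfderiv_fun_add (mdifferentiableAt_inner (d hYZ) (d hW))
    (mdifferentiableAt_inner (d hZ) (d hYW)), add_apply,
    mvfderiv_inner (d hX) (d hYZ) (d hW), mvfderiv_inner (d hX) (d hZ) (d hYW)]
  ring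

/-- `R(X, Y)` is skew-symmetric. -/
theorem inner_curvature_skew (hX : CMDiffAt ∞ (T% X) x) (hY : CMDiffAt ∞ (T% Y) x)
    (hZ : CMDiffAt ∞ (T% Z) x) (hW : CMDiffAt ∞ (T% W) x) :
    (inner ℝ (curvature X Y Z x) (W x) : ℝ) = -inner ℝ (curvature X Y W x) (Z x) := by
  have h1 := mvfderiv_mlieBracket (smoothAt_inner hZ hW) hX hY
  rw [mvfderiv_mvfderiv_inner hX hY hZ hW, mvfderiv_mvfderiv_inner hY hX hZ hW,
    mvfderiv_inner (mdiffAt_of_smoothAt (smoothAt_mlieBracket hX hY)) (mdiffAt_of_smoothAt hZ)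
      (mdiffAt_of_smoothAt hW)] at h1
  simp only [curvature_eq_nabla, Pi.sub_apply, inner_sub_left]
  simp only [real_inner_comm (Z x)] at h1 ⊢
  linarith

/-- The derivative of `f` along `Y` enters through `∇_Y ∇_{fX} Z` and through `[fX, Y]`, and the two
contributions cancel. -/
theorem curvature_tensorial (hZ : CMDiffAt ∞ (T% Z) x) :
    TensorialAt I E (fun X => curvature X Y Z x) x where
  smul {f X} hf hX := by
    have h1 : MDiffAt (T% (nabla X Z)) x := mdiffAt_leviCivita hX hZ
    have h2 : nabla (f • X) Z = f • nabla X Z := by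
      funext y
      exact nabla_smul_left
    simp only [curvature_eq_nabla, Pi.sub_apply, h2, nabla_smul_left, nabla_smul_right hf h1]
    simp only [nabla, mlieBracket_smul_left hf hX, map_add, map_smul]
    module
  add {X X'} hX hX' := by
    have h1 : MDiffAt (T% (nabla X Z)) x := mdiffAt_leviCivita hX hZ
    have h1' : MDiffAt (T% (nabla X' Z)) x := mdiffAt_leviCivita hX' hZ
    have h2 : nabla (X + X') Z = nabla X Z + nabla X' Z := by
      funext y
      exact nabla_add_left
    simp only [curvature_eq_nabla, Pi.sub_apply, h2, nabla_add_left, nabla_add_right h1 h1']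
    simp only [nabla, mlieBracket_add_left hX hX', map_add]
    module

/-- Skew-symmetry moves `Z` out of the curvature into the other factor of the inner product, where
only its value at `x` counts. -/
theorem curvature_congr_right (hX : CMDiffAt ∞ (T% X) x) (hY : CMDiffAt ∞ (T% Y) x)
    (hZ : CMDiffAt ∞ (T% Z) x) (hZ' : CMDiffAt ∞ (T% Z') x) (h : Z x = Z' x) :
    curvature X Y Z x = curvature X Y Z' x := by
  refine ext_inner_right ℝ fun w => ?_
  have hw : CMDiffAt ∞ (T% (extend E w)) x := contMDiffAt_extend I E w
  have h1 := inner_curvature_skew hX hY hZ hw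
  have h2 := inner_curvature_skew hX hY hZ' hw
  rw [extend_apply_self] at h1 h2
  rw [h1, h2, h]

/-- The value at `x` of the curvature of vector fields depends on their values at `x` only. -/
theorem curvature_eq_riemann (hX : CMDiffAt ∞ (T% X) x) (hY : CMDiffAt ∞ (T% Y) x)
    (hZ : CMDiffAt ∞ (T% Z) x) : curvature X Y Z x = riemann x (X x) (Y x) (Z x) := by
  have he (w : TangentSpace I x) : CMDiffAt ∞ (T% (extend E w)) x := contMDiffAt_extend I E w
  have d {A : Π x : M, TangentSpace I x} (hA : CMDiffAt ∞ (T% A) x) := mdiffAt_of_smoothAt hA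
  rw [riemann, curvature_congr_right hX hY hZ (he (Z x)) (by simp),
    (curvature_tensorial (he (Z x))).pointwise (d hX) (d (he (X x))) (by simp),
    curvature_swap, (curvature_tensorial (he (Z x))).pointwise (d hY) (d (he (Y x)))
      (by simp), ← curvature_swap]

/-- `R(·, v)w` as a linear map. -/
def riemannLin (x : M) (v w : TangentSpace I x) : TangentSpace I x →L[ℝ] TangentSpace I x :=
  TensorialAt.mkHom (fun X => curvature X (extend E v) (extend E w) x) x
    (curvature_tensorial (contMDiffAt_extend I E w))

theorem riemannLin_apply (u v w : TangentSpace I x) : riemannLin x v w u = riemann x u v w := rfl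

theorem riemann_sub_left (u u' v w : TangentSpace I x) :
    riemann x (u - u') v w = riemann x u v w - riemann x u' v w := by
  simp only [← riemannLin_apply, map_sub]

/-- The Ricci tensor may be computed in any orthonormal frame. -/
theorem ric_eq_sum {v : Fin (Module.finrank ℝ E) → TangentSpace I x} (hv : Orthonormal ℝ v)
    (u w : TangentSpace I x) :
    ric x u w = ∑ i, inner ℝ (riemann x (v i) u w) (v i) := by
  have h1 := (riemannLin x u w).toLinearMap.trace_eq_sum_inner
    (stdOrthonormalBasis ℝ (TangentSpace I x))
  have h2 := (riemannLin x u w).toLinearMap.trace_eq_sum_inner (tangentOrthonormalBasis hv)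
  rw [h1] at h2
  simpa [ric, riemannLin_apply, tangentOrthonormalBasis_apply, real_inner_comm] using h2

end

/-! ### The second Bianchi identity and its contraction -/

section

variable {f : M → ℝ} {U X Y Z W : Π x : M, TangentSpace I x} {x : M}

/-- The covariant derivative `(∇_X R)(Y, Z)W` of the curvature tensor. -/
def nablaCurvature (X Y Z W : Π x : M, TangentSpace I x) (x : M) : TangentSpace I x :=
  nabla X (curvature Y Z W) x - curvature (nabla X Y) Z W x - curvature Y (nabla X Z) W x
    - curvature Y Z (nabla X W) x

/-- The covariant derivative `(∇_X Ric)(Y, Z)` of the Ricci tensor. -/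
def nablaRic (X Y Z : Π x : M, TangentSpace I x) (x : M) : ℝ :=
  mvfderiv I (fun y => ric y (Y y) (Z y)) x (X x) - ric x (nabla X Y x) (Z x)
    - ric x (Y x) (nabla X Z x)

theorem nabla_curvature (hX : CMDiffAt ∞ (T% X) x) (hY : CMDiffAt ∞ (T% Y) x)
    (hZ : CMDiffAt ∞ (T% Z) x) :
    nabla W (curvature X Y Z) x = nabla W (nabla X (nabla Y Z)) x - nabla W (nabla Y (nabla X Z)) x
      - nabla W (nabla (mlieBracket I X Y) Z) x := by
  have h1 := smoothAt_nabla hX (smoothAt_nabla hY hZ)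
  have h2 := smoothAt_nabla hY (smoothAt_nabla hX hZ)
  have h3 := smoothAt_nabla (smoothAt_mlieBracket hX hY) hZ
  rw [curvature_eq_nabla, nabla_sub_right (mdiffAt_of_smoothAt (h1.sub_section h2))
    (mdiffAt_of_smoothAt h3), nabla_sub_right (mdiffAt_of_smoothAt h1) (mdiffAt_of_smoothAt h2)]

/-- Torsion-freeness seen through the first slot of the curvature; it merges the correction terms of
the second Bianchi identity in pairs. -/
theorem curvature_sub_curvature_nabla (hX : CMDiffAt ∞ (T% X) x) (hY : CMDiffAt ∞ (T% Y) x)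
    (hZ : CMDiffAt ∞ (T% Z) x) (hW : CMDiffAt ∞ (T% W) x) :
    curvature (nabla X Y) Z W x - curvature (nabla Y X) Z W x =
      curvature (mlieBracket I X Y) Z W x := by
  rw [curvature_eq_riemann (smoothAt_nabla hX hY) hZ hW,
    curvature_eq_riemann (smoothAt_nabla hY hX) hZ hW,
    curvature_eq_riemann (smoothAt_mlieBracket hX hY) hZ hW, ← riemann_sub_left,
    nabla_sub_nabla (mdiffAt_of_smoothAt hX) (mdiffAt_of_smoothAt hY)]

theorem mlieBracket_jacobi_cyclic (hX : CMDiffAt ∞ (T% X) x) (hY : CMDiffAt ∞ (T% Y) x)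
    (hZ : CMDiffAt ∞ (T% Z) x) :
    mlieBracket I (mlieBracket I X Y) Z x + mlieBracket I (mlieBracket I Y Z) X x
      + mlieBracket I (mlieBracket I Z X) Y x = 0 := by
  have h := mlieBracket_jacobi hX hY hZ
  rw [mlieBracket_swap_apply (V := X), mlieBracket_swap_apply (V := Y),
    mlieBracket_swap (V := X) (W := Z)] at h
  have h4 : mlieBracket I (-mlieBracket I Z X) Y x = -mlieBracket I (mlieBracket I Z X) Y x := by
    have h5 := mlieBracket_const_smul_left (I := I) (W := Y) (c := (-1 : ℝ))
      (mdiffAt_of_smoothAt (smoothAt_mlieBracket hZ hX))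
    simpa using h5
  rw [h4, neg_neg] at h
  rw [← sub_eq_zero.2 h.symm]
  abel

/-- The second Bianchi identity. -/
theorem nablaCurvature_cyclic (hX : CMDiffAt ∞ (T% X) x) (hY : CMDiffAt ∞ (T% Y) x)
    (hZ : CMDiffAt ∞ (T% Z) x) (hW : CMDiffAt ∞ (T% W) x) :
    nablaCurvature X Y Z W x + nablaCurvature Y Z X W x + nablaCurvature Z X Y W x = 0 := by
  have h1 := curvature_sub_curvature_nabla hX hY hZ hW
  have h2 := curvature_sub_curvature_nabla hY hZ hX hW
  have h3 := curvature_sub_curvature_nabla hZ hX hY hW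
  have h4 : nabla (mlieBracket I (mlieBracket I X Y) Z) W x
      + nabla (mlieBracket I (mlieBracket I Y Z) X) W x
      + nabla (mlieBracket I (mlieBracket I Z X) Y) W x = 0 := by
    simp only [nabla, ← map_add, mlieBracket_jacobi_cyclic hX hY hZ, map_zero]
  simp only [nablaCurvature, nabla_curvature hY hZ hW, nabla_curvature hZ hX hW,
    nabla_curvature hX hY hW]
  rw [curvature_swap (X := Y) (Y := nabla X Z), curvature_swap (X := Z) (Y := nabla Y X),
    curvature_swap (X := X) (Y := nabla Z Y)]
  rw [sub_eq_iff_eq_add] at h1 h2 h3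
  rw [h1, h2, h3]
  simp only [curvature_eq_nabla, Pi.sub_apply]
  -- The third-order covariant derivatives cancel in pairs; what remains is the Jacobi sum of `h4`.
  rw [← h4]
  abel

/-- `(∇_X R)(Y, Z)` is skew-symmetric. -/
theorem inner_nablaCurvature_skew (hX : CMDiffAt ∞ (T% X) x)
    (hY : ∀ᶠ y in 𝓝 x, CMDiffAt ∞ (T% Y) y) (hZ : ∀ᶠ y in 𝓝 x, CMDiffAt ∞ (T% Z) y)
    (hW : ∀ᶠ y in 𝓝 x, CMDiffAt ∞ (T% W) y) (hU : ∀ᶠ y in 𝓝 x, CMDiffAt ∞ (T% U) y) :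
    (inner ℝ (nablaCurvature X Y Z W x) (U x) : ℝ) =
      -inner ℝ (nablaCurvature X Y Z U x) (W x) := by
  have hY0 := hY.self_of_nhds
  have hZ0 := hZ.self_of_nhds
  have hW0 := hW.self_of_nhds
  have hU0 := hU.self_of_nhds
  have hev : (fun y => (inner ℝ (curvature Y Z W y) (U y) : ℝ)) =ᶠ[𝓝 x]
      fun y => -(inner ℝ (curvature Y Z U y) (W y) : ℝ) := by
    filter_upwards [hY, hZ, hW, hU] with y h1 h2 h3 h4
    exact inner_curvature_skew h1 h2 h3 h4
  have h1 := congrArg (fun L => L (X x)) (mvfderiv_congr hev)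
  simp only [mvfderiv_fun_neg, neg_apply] at h1
  rw [mvfderiv_inner (mdiffAt_of_smoothAt hX) (mdiffAt_of_smoothAt (smoothAt_curvature hY0 hZ0 hW0))
      (mdiffAt_of_smoothAt hU0),
    mvfderiv_inner (mdiffAt_of_smoothAt hX) (mdiffAt_of_smoothAt (smoothAt_curvature hY0 hZ0 hU0))
      (mdiffAt_of_smoothAt hW0)] at h1
  simp only [nablaCurvature, inner_sub_left]
  have h2 := inner_curvature_skew (smoothAt_nabla hX hY0) hZ0 hW0 hU0
  have h3 := inner_curvature_skew hY0 (smoothAt_nabla hX hZ0) hW0 hU0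
  have h4 := inner_curvature_skew hY0 hZ0 (smoothAt_nabla hX hW0) hU0
  have h5 := inner_curvature_skew hY0 hZ0 (smoothAt_nabla hX hU0) hW0
  linarith

theorem nablaCurvature_swap (hY : CMDiffAt ∞ (T% Y) x)
    (hZ : CMDiffAt ∞ (T% Z) x) (hW : CMDiffAt ∞ (T% W) x) :
    nablaCurvature X Y Z W x = -nablaCurvature X Z Y W x := by
  have h : curvature Y Z W = (-1 : ℝ) • curvature Z Y W := by
    funext y
    rw [curvature_swap]
    simp
  simp only [nablaCurvature]
  rw [h, nabla_const_smul_right _ (mdiffAt_of_smoothAt (smoothAt_curvature hZ hY hW)),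
    curvature_swap (X := nabla X Y), curvature_swap (X := Y) (Y := nabla X Z),
    curvature_swap (X := Y) (Y := Z)]
  module

/-- An infinitesimal rotation `d` of an orthonormal basis does not change a trace: the skew matrix
of `d` is paired with a symmetric expression in `T`. -/
theorem sum_inner_add_eq_zero {v d : Fin (Module.finrank ℝ E) → TangentSpace I x}
    (hv : Orthonormal ℝ v) (hd : ∀ i j, (inner ℝ (d i) (v j) : ℝ) = -inner ℝ (d j) (v i))
    (T : TangentSpace I x →L[ℝ] TangentSpace I x) :
    ∑ i, ((inner ℝ (T (d i)) (v i) : ℝ) + inner ℝ (T (v i)) (d i)) = 0 := by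
  have h1 (i) : (inner ℝ (T (d i)) (v i) : ℝ) =
      ∑ j, inner ℝ (v j) (d i) * inner ℝ (T (v j)) (v i) := by
    conv_lhs => rw [← sum_inner_smul hv (d i)]
    simp [sum_inner, inner_smul_left]
  have h2 (i) : (inner ℝ (T (v i)) (d i) : ℝ) =
      ∑ j, inner ℝ (v j) (d i) * inner ℝ (T (v i)) (v j) := by
    conv_lhs => rw [← sum_inner_smul hv (d i)]
    simp [inner_sum, inner_smul_right]
  rw [Finset.sum_add_distrib]
  simp only [h1, h2]
  rw [Finset.sum_comm, ← Finset.sum_add_distrib]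
  refine Finset.sum_eq_zero fun i _ => ?_
  rw [← Finset.sum_add_distrib]
  refine Finset.sum_eq_zero fun j _ => ?_
  rw [real_inner_comm, hd, real_inner_comm (d i)]
  ring

theorem mdiffAt_sum {ι : Type*} {s : Finset ι} {g : ι → M → ℝ} (hg : ∀ i ∈ s, MDiffAt (g i) x) :
    MDiffAt (fun y => ∑ i ∈ s, g i y) x ∧
      mvfderiv I (fun y => ∑ i ∈ s, g i y) x = ∑ i ∈ s, mvfderiv I (g i) x := by
  classical
  induction s using Finset.induction_on with
  | empty => exact ⟨by simpa using! mdifferentiableAt_const, by simpa using! mvfderiv_const 0⟩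
  | insert i s hi ih =>
    obtain ⟨h1, h2⟩ := ih fun j hj => hg j (Finset.mem_insert_of_mem hj)
    have h3 := hg i (Finset.mem_insert_self i s)
    simp only [Finset.sum_insert hi]
    exact ⟨h3.add h1, by rw [mvfderiv_fun_add h3 h1, h2]⟩

/-- The covariant derivative of the Ricci tensor is the trace of that of the curvature tensor. -/
theorem sum_inner_nablaCurvature {e : Fin (Module.finrank ℝ E) → Π x : M, TangentSpace I x}
    (he : IsOrthonormalFrameAt e x) (hX : CMDiffAt ∞ (T% X) x)
    (hY : ∀ᶠ y in 𝓝 x, CMDiffAt ∞ (T% Y) y) (hZ : ∀ᶠ y in 𝓝 x, CMDiffAt ∞ (T% Z) y) :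
    ∑ i, inner ℝ (nablaCurvature X (e i) Y Z x) (e i x) = nablaRic X Y Z x := by
  have hY0 := hY.self_of_nhds
  have hZ0 := hZ.self_of_nhds
  have he0 := he.smooth.self_of_nhds
  have ho := he.orthonormal.self_of_nhds
  have d {A : Π x : M, TangentSpace I x} (hA : CMDiffAt ∞ (T% A) x) := mdiffAt_of_smoothAt hA
  have hev : (fun y => ric y (Y y) (Z y)) =ᶠ[𝓝 x]
      fun y => ∑ i, inner ℝ (curvature (e i) Y Z y) (e i y) := by
    filter_upwards [hY, hZ, he.smooth, he.orthonormal] with y h1 h2 h3 h4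
    rw [ric_eq_sum h4]
    exact Finset.sum_congr rfl fun i _ => by rw [curvature_eq_riemann (h3 i) h1 h2]
  -- The inner products of the frame are constant near `x`, so the frame moves by an infinitesimal
  -- rotation and its own derivatives drop out of the trace.
  have hskew (i j) : (inner ℝ (nabla X (e i) x) (e j x) : ℝ) =
      -inner ℝ (nabla X (e j) x) (e i x) := by
    have hc : (fun y => (inner ℝ (e i y) (e j y) : ℝ)) =ᶠ[𝓝 x]
        fun _ => if i = j then 1 else 0 := by
      filter_upwards [he.orthonormal] with y h
      exact orthonormal_iff_ite.1 h i j
    have h1 := congrArg (fun L => L (X x)) (mvfderiv_congr hc)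
    rw [mvfderiv_const, mvfderiv_inner (d hX) (d (he0 i)) (d (he0 j)), zero_apply,
      real_inner_comm _ (e i x)] at h1
    linarith
  have hsum := sum_inner_add_eq_zero ho hskew (riemannLin x (Y x) (Z x))
  have hc (i) := smoothAt_curvature (he0 i) hY0 hZ0
  rw [nablaRic, mvfderiv_congr hev,
    (mdiffAt_sum fun i _ => mdifferentiableAt_inner (d (hc i)) (d (he0 i))).2,
    sum_apply, ric_eq_sum ho, ric_eq_sum ho, ← Finset.sum_sub_distrib,
    ← Finset.sum_sub_distrib, ← add_zero (Finset.sum _ _), ← hsum, ← Finset.sum_add_distrib]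
  refine Finset.sum_congr rfl fun i _ => ?_
  rw [mvfderiv_inner (d hX) (d (hc i)) (d (he0 i)), nablaCurvature,
    curvature_eq_riemann (smoothAt_nabla hX (he0 i)) hY0 hZ0,
    curvature_eq_riemann (he0 i) (smoothAt_nabla hX hY0) hZ0,
    curvature_eq_riemann (he0 i) hY0 (smoothAt_nabla hX hZ0),
    curvature_eq_riemann (he0 i) hY0 hZ0]
  simp only [riemannLin_apply, inner_sub_left]
  ring

/-- The contracted second Bianchi identity, `d scal = 2 div Ric`. -/
theorem sum_nablaRic {e : Fin (Module.finrank ℝ E) → Π x : M, TangentSpace I x}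
    (he : IsOrthonormalFrameAt e x) (hX : ∀ᶠ y in 𝓝 x, CMDiffAt ∞ (T% X) y) :
    ∑ j, nablaRic X (e j) (e j) x = 2 * ∑ j, nablaRic (e j) X (e j) x := by
  have hX0 := hX.self_of_nhds
  have hes := Filter.eventually_all.1 he.smooth
  have he0 := he.smooth.self_of_nhds
  have hB (i j) : (inner ℝ (nablaCurvature X (e i) (e j) (e j) x) (e i x) : ℝ) =
      inner ℝ (nablaCurvature (e i) (e j) X (e i) x) (e j x)
        + inner ℝ (nablaCurvature (e j) (e i) X (e j) x) (e i x) := by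
    have h1 := congrArg (fun w => (inner ℝ w (e i x) : ℝ))
      (nablaCurvature_cyclic hX0 (he0 i) (he0 j) (he0 j))
    simp only [inner_add_left, inner_zero_left] at h1
    rw [nablaCurvature_swap hX0 (he0 i) (he0 j), inner_neg_left,
      inner_nablaCurvature_skew (he0 i) (hes j) hX (hes j) (hes i)] at h1
    linarith
  have h1 (j) := sum_inner_nablaCurvature he hX0 (hes j) (hes j)
  have h2 (j) := sum_inner_nablaCurvature he (he0 j) hX (hes j)
  simp only [← h1, ← h2, hB, Finset.sum_add_distrib, two_mul]
  -- The two terms of `hB` are exchanged by swapping `i` and `j`, whence the factor `2`.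
  rw [add_left_inj, Finset.sum_comm]

end

/-! ### Gradients and collinearity -/

theorem eventually_smoothAt_extend {x : M} (u : TangentSpace I x) :
    ∀ᶠ y in 𝓝 x, CMDiffAt ∞ (T% (extend E u)) y := by
  obtain ⟨s, hs, h⟩ := exists_contMDiffOn_extend (k := ∞) I E u
  filter_upwards [eventually_mem_nhds_iff.2 hs] with y hy
  exact h.contMDiffAt hy

theorem inner_grad (f : M → ℝ) (x : M) (u : TangentSpace I x) :
    (inner ℝ (grad I f x) u : ℝ) = mvfderiv I f x u := by
  have : CompleteSpace (TangentSpace I x) := FiniteDimensional.complete ℝ _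
  exact InnerProductSpace.toDual_symm_apply

theorem grad_eq_iff {f : M → ℝ} {x : M} {w : TangentSpace I x} :
    grad I f x = w ↔ ∀ u, mvfderiv I f x u = inner ℝ w u := by
  refine ⟨fun h u => by rw [← h, inner_grad], fun h => ext_inner_right ℝ fun u => ?_⟩
  rw [inner_grad, h]

theorem areCollinear_of_forall_smul {W V : Π x : M, TangentSpace I x}
    (h : ∀ x, V x ≠ 0 → ∃ c : ℝ, W x = c • V x) : AreCollinear W V := by
  intro x
  by_cases hx : V x = 0
  · exact ⟨0, 1, Or.inr one_ne_zero, by simp [hx]⟩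
  · obtain ⟨c, hc⟩ := h x hx
    exact ⟨1, -c, Or.inl one_ne_zero, by rw [hc]; module⟩

theorem areCollinear_of_finrank_le_one (hE : Module.finrank ℝ E ≤ 1)
    (W V : Π x : M, TangentSpace I x) : AreCollinear W V := by
  refine areCollinear_of_forall_smul fun x hx => ?_
  have h1 : Module.finrank ℝ (TangentSpace I x) = 1 := by
    have : 0 < Module.finrank ℝ (TangentSpace I x) :=
      Module.finrank_pos_iff_exists_ne_zero.2 ⟨V x, hx⟩
    exact le_antisymm hE this
  obtain ⟨c, hc⟩ := exists_smul_eq_of_finrank_eq_one h1 hx (W x)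
  exact ⟨c, hc.symm⟩

variable {V X Y Z : Π x : M, TangentSpace I x} {lam mu : M → ℝ} {a : ℝ}

/-! ### Concircular fields: curvature and zeros -/

namespace IsConcircular

section
variable (hV : IsConcircular V (fun _ => a))
include hV

theorem smoothAt (x : M) : CMDiffAt ∞ (T% V) x := hV.smooth_field x

theorem smoothAt_inner_self (x : M) : CMDiffAt ∞ (fun y => (inner ℝ (V y) (V y) : ℝ)) x :=
  smoothAt_inner (hV.smoothAt x) (hV.smoothAt x)

theorem nabla_eq (X : Π x : M, TangentSpace I x) : nabla X V = a • X := by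
  funext x
  exact hV.cov_eq x (X x)

theorem lieDerivMetric_eq (x : M) (u v : TangentSpace I x) :
    lieDerivMetric V x u v = 2 * a * inner ℝ u v := by
  have hd := mdiffAt_of_smoothAt (hV.smoothAt x)
  have hu := mdifferentiableAt_extend I E u
  have hv := mdifferentiableAt_extend I E v
  rw [lieDerivMetric, mvfderiv_inner hd hu hv, ← nabla_sub_nabla hd hu, ← nabla_sub_nabla hd hv,
    hV.nabla_eq, hV.nabla_eq]
  simp only [Pi.smul_apply, extend_apply_self, inner_sub_left, inner_sub_right, inner_smul_left,
    inner_smul_right, RCLike.conj_to_real]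
  ring

theorem riemann_eq_zero (x : M) (u v : TangentSpace I x) : riemann x u v (V x) = 0 := by
  have hu : CMDiffAt ∞ (T% (extend E u)) x := contMDiffAt_extend I E u
  have hv : CMDiffAt ∞ (T% (extend E v)) x := contMDiffAt_extend I E v
  have h := curvature_eq_riemann hu hv (hV.smoothAt x)
  rw [extend_apply_self, extend_apply_self] at h
  rw [← h, curvature_eq_nabla, Pi.sub_apply, Pi.sub_apply, hV.nabla_eq, hV.nabla_eq, hV.nabla_eq,
    nabla_const_smul_right _ (mdiffAt_of_smoothAt hv),
    nabla_const_smul_right _ (mdiffAt_of_smoothAt hu), Pi.smul_apply,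
    ← nabla_sub_nabla (mdiffAt_of_smoothAt hu) (mdiffAt_of_smoothAt hv)]
  module

theorem ric_eq_zero (x : M) (u : TangentSpace I x) : ric x u (V x) = 0 := by
  simp [ric, hV.riemann_eq_zero]

theorem mvfderiv_inner_left (x : M) (hX : MDiffAt (T% X) x) (u : TangentSpace I x) :
    mvfderiv I (fun y => (inner ℝ (V y) (X y) : ℝ)) x u =
      a * inner ℝ u (X x) + inner ℝ (V x) (leviCivita I M X x u) := by
  have h := mvfderiv_inner (mdifferentiableAt_extend I E u) (mdiffAt_of_smoothAt (hV.smoothAt x)) hX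
  rw [hV.nabla_eq] at h
  simpa [nabla, inner_smul_left] using h

theorem mvfderiv_inner_self (x : M) (u : TangentSpace I x) :
    mvfderiv I (fun y => (inner ℝ (V y) (V y) : ℝ)) x u = 2 * a * inner ℝ (V x) u := by
  rw [hV.mvfderiv_inner_left x (mdiffAt_of_smoothAt (hV.smoothAt x)), hV.cov_eq, inner_smul_right,
    real_inner_comm]
  ring

/-- If `V` vanished near `x`, then `a u = ∇_u V = 0` for every `u`, impossible in positive
dimension. -/
theorem frequently_ne_zero (ha : a ≠ 0) (hE : 0 < Module.finrank ℝ E) (x : M) :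
    ∃ᶠ y in 𝓝 x, V y ≠ 0 := by
  intro h
  have h0 : V =ᶠ[𝓝 x] 0 := by
    filter_upwards [h] with y hy
    exact not_not.1 hy
  have hd0 : MDiffAt (T% (0 : Π x : M, TangentSpace I x)) x := mdifferentiableAt_zeroSection ..
  have : Nontrivial (TangentSpace I x) :=
    Module.nontrivial_of_finrank_pos (R := ℝ) (M := TangentSpace I x) hE
  obtain ⟨u, hu⟩ := exists_ne (0 : TangentSpace I x)
  have h1 := nabla_congr_right (X := extend E u) (mdiffAt_of_smoothAt (hV.smoothAt x)) hd0 h0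
  rw [hV.nabla_eq, nabla, CovariantDerivative.zero] at h1
  simp [ha, hu] at h1

/-- Allows division by `|V|²`: a continuous identity need only be checked where `V ≠ 0`. -/
theorem eq_zero_of_continuousAt (ha : a ≠ 0) (hE : 0 < Module.finrank ℝ E) {g : M → ℝ} {x : M}
    (hg : ContinuousAt g x) (h0 : ∀ y, V y ≠ 0 → g y = 0) : g x = 0 := by
  by_contra h
  obtain ⟨y, hy, hy'⟩ := ((hV.frequently_ne_zero ha hE x).and_eventually (hg.eventually_ne h)).exists
  exact hy' (h0 y hy)

end

end IsConcircular

/-! ### The soliton equation and the differentials of `lam`, `mu` and `scal` -/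

namespace IsAlmostEtaRicciSoliton

section
variable (hV : IsConcircular V (fun _ => a)) (hsol : IsAlmostEtaRicciSoliton V lam mu (flat V))
include hV hsol

theorem ric_eq (x : M) (u v : TangentSpace I x) :
    ric x u v = (lam x - a) * inner ℝ u v + mu x * (flat V x u * flat V x v) := by
  have h := hsol.soliton_eq x u v
  rw [hV.lieDerivMetric_eq] at h
  linarith

theorem ric_eq_inner (x : M) (u v : TangentSpace I x) :
    ric x u v = (lam x - a) * inner ℝ u v + mu x * (inner ℝ (V x) u * inner ℝ (V x) v) :=
  ric_eq hV hsol x u v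

theorem lam_sub (ha : a ≠ 0) (hE : 0 < Module.finrank ℝ E) (x : M) :
    lam x - a + mu x * inner ℝ (V x) (V x) = 0 := by
  refine hV.eq_zero_of_continuousAt (g := fun y => lam y - a + mu y * inner ℝ (V y) (V y)) ha hE
    (((hsol.smooth_lam x).continuousAt.sub continuousAt_const).add
      ((hsol.smooth_mu x).continuousAt.mul
        (hV.smoothAt_inner_self x).continuousAt)) fun y hy => ?_
  have h := hV.ric_eq_zero y (V y)
  rw [ric_eq_inner hV hsol] at h
  have h' : (inner ℝ (V y) (V y) : ℝ) ≠ 0 := inner_self_ne_zero.2 hy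
  refine mul_left_cancel₀ h' ?_
  linarith

theorem scal_eq : (scal I : M → ℝ) = fun x =>
    Module.finrank ℝ E * (lam x - a) + mu x * inner ℝ (V x) (V x) := by
  funext x
  simp only [scal, ric_eq_inner hV hsol, Finset.sum_add_distrib, ← Finset.mul_sum]
  congr 1
  · have hr : Module.finrank ℝ (TangentSpace I x) = Module.finrank ℝ E := rfl
    simp [hr, mul_comm]
  · congr 1
    rw [← (stdOrthonormalBasis ℝ (TangentSpace I x)).sum_inner_mul_inner (V x) (V x)]
    simp only [real_inner_comm (V x)]

theorem smooth_scal : ContMDiff I 𝓘(ℝ, ℝ) ∞ (scal I : M → ℝ) := by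
  rw [scal_eq hV hsol]
  intro x
  exact (contMDiffAt_const.mul ((hsol.smooth_lam x).sub contMDiffAt_const)).add
    ((hsol.smooth_mu x).mul (hV.smoothAt_inner_self x))

theorem nablaRic_eq (x : M) (hX : MDiffAt (T% X) x) (hY : MDiffAt (T% Y) x)
    (hZ : MDiffAt (T% Z) x) :
    nablaRic X Y Z x = mvfderiv I lam x (X x) * inner ℝ (Y x) (Z x)
      + mvfderiv I mu x (X x) * (inner ℝ (V x) (Y x) * inner ℝ (V x) (Z x))
      + mu x * a * (inner ℝ (X x) (Y x) * inner ℝ (V x) (Z x)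
        + inner ℝ (V x) (Y x) * inner ℝ (X x) (Z x)) := by
  have hd := mdiffAt_of_smoothAt (hV.smoothAt x)
  have hl := (hsol.smooth_lam x).mdifferentiableAt (by simp)
  have hm := (hsol.smooth_mu x).mdifferentiableAt (by simp)
  have hVY := mdifferentiableAt_inner hd hY
  have hVZ := mdifferentiableAt_inner hd hZ
  have hYZ := mdifferentiableAt_inner hY hZ
  have hla : MDiffAt (fun y => lam y - a) x := hl.sub mdifferentiableAt_const
  have hVV : MDiffAt (fun y => (inner ℝ (V y) (Y y) : ℝ) * inner ℝ (V y) (Z y)) x := hVY.mul hVZ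
  have h1 : MDiffAt (fun y => (lam y - a) * inner ℝ (Y y) (Z y)) x := hla.mul hYZ
  have h2 : MDiffAt (fun y => mu y * ((inner ℝ (V y) (Y y) : ℝ) * inner ℝ (V y) (Z y))) x :=
    hm.mul hVV
  simp only [nablaRic, ric_eq_inner hV hsol]
  rw [mvfderiv_fun_add h1 h2, mvfderiv_fun_mul hla hYZ,
    mvfderiv_fun_mul hm hVV, mvfderiv_fun_mul hVY hVZ,
    mvfderiv_fun_sub hl mdifferentiableAt_const, mvfderiv_const]
  simp only [add_apply, smul_apply, sub_zero, smul_eq_mul, mvfderiv_inner hX hY hZ,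
    hV.mvfderiv_inner_left x hY, hV.mvfderiv_inner_left x hZ]
  simp only [nabla]
  ring

/-- This is `d scal = 2 div Ric` for `Ric = (λ - a) g + μ η ⊗ η`. The traces `e1` and `e2`
contribute `2` and `n + 1` times `aμη(u)`; with the factor `2` before the divergence, `2(n + 1) - 2
= 2n` is the final coefficient. -/
theorem contracted_bianchi (x : M) (u : TangentSpace I x) :
    ((Module.finrank ℝ E : ℝ) - 2) * mvfderiv I lam x u
      + inner ℝ (V x) (V x) * mvfderiv I mu x u =
    inner ℝ (V x) u * (2 * mvfderiv I mu x (V x) + 2 * Module.finrank ℝ E * a * mu x) := by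
  obtain ⟨e, he⟩ := exists_isOrthonormalFrameAt (I := I) x
  have ho := he.orthonormal.self_of_nhds
  have hu := mdifferentiableAt_extend I E u
  have hes (i) := mdiffAt_of_smoothAt (he.smooth.self_of_nhds i)
  have h := sum_nablaRic he (eventually_smoothAt_extend u)
  simp only [nablaRic_eq hV hsol x hu (hes _) (hes _), nablaRic_eq hV hsol x (hes _) hu (hes _),
    extend_apply_self] at h
  have hn (i) : (inner ℝ (e i x) (e i x) : ℝ) = 1 := by
    simpa using orthonormal_iff_ite.1 ho i i
  have hlin (L : TangentSpace I x →L[ℝ] ℝ) (w : TangentSpace I x) :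
      ∑ i, L (e i x) * (inner ℝ w (e i x) : ℝ) = L w := by
    conv_rhs => rw [← sum_inner_smul ho w]
    simp [map_sum, mul_comm, real_inner_comm]
  have hVV : ∑ i, (inner ℝ (V x) (e i x) : ℝ) * inner ℝ (V x) (e i x) = inner ℝ (V x) (V x) :=
    hlin (innerSL ℝ (V x)) (V x)
  have huV : ∑ i, (inner ℝ u (e i x) : ℝ) * inner ℝ (V x) (e i x) = inner ℝ u (V x) :=
    hlin (innerSL ℝ u) (V x)
  have hL := hlin (mvfderiv I lam x) u
  have hM := hlin (mvfderiv I mu x) (V x)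
  have e1 : ∑ j, (mvfderiv I lam x u * inner ℝ (e j x) (e j x) + mvfderiv I mu x u *
        (inner ℝ (V x) (e j x) * inner ℝ (V x) (e j x)) + mu x * a *
        (inner ℝ u (e j x) * inner ℝ (V x) (e j x) + inner ℝ (V x) (e j x) * inner ℝ u (e j x))) =
      Module.finrank ℝ E * mvfderiv I lam x u + mvfderiv I mu x u * inner ℝ (V x) (V x)
        + 2 * (mu x * a) * inner ℝ u (V x) := by
    simp only [hn, Finset.sum_add_distrib, ← Finset.mul_sum, hVV, huV,
      mul_comm (inner ℝ (V x) (e _ x) : ℝ) (inner ℝ u (e _ x))]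
    simp
    ring
  have e2 : ∑ j, (mvfderiv I lam x (e j x) * inner ℝ u (e j x) + mvfderiv I mu x (e j x) *
        (inner ℝ (V x) u * inner ℝ (V x) (e j x)) + mu x * a *
        (inner ℝ (e j x) u * inner ℝ (V x) (e j x) + inner ℝ (V x) u * inner ℝ (e j x) (e j x))) =
      mvfderiv I lam x u + inner ℝ (V x) u * mvfderiv I mu x (V x)
        + mu x * a * (inner ℝ u (V x) + Module.finrank ℝ E * inner ℝ (V x) u) := by
    have h3 (j) : mvfderiv I mu x (e j x) * ((inner ℝ (V x) u : ℝ) * inner ℝ (V x) (e j x)) =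
        inner ℝ (V x) u * (mvfderiv I mu x (e j x) * inner ℝ (V x) (e j x)) := by ring
    simp only [hn, h3, Finset.sum_add_distrib, ← Finset.mul_sum, hL, hM,
      real_inner_comm u (e _ x), huV]
    simp only [mul_one, Finset.sum_const, Finset.card_univ, Fintype.card_fin, nsmul_eq_mul]
    ring
  rw [e1, e2, real_inner_comm (V x) u] at h
  linarith

theorem mvfderiv_lam (ha : a ≠ 0) (hE : 0 < Module.finrank ℝ E) (x : M) (u : TangentSpace I x) :
    mvfderiv I lam x u = -(inner ℝ (V x) (V x) * mvfderiv I mu x u)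
      - 2 * a * mu x * inner ℝ (V x) u := by
  have hl : lam = fun y => a - mu y * inner ℝ (V y) (V y) := by
    funext y
    linarith [lam_sub hV hsol ha hE y]
  have hm := (hsol.smooth_mu x).mdifferentiableAt (by simp)
  have hf := (hV.smoothAt_inner_self x).mdifferentiableAt (by simp)
  have hmf : MDiffAt (fun y => mu y * inner ℝ (V y) (V y)) x := hm.mul hf
  rw [hl, mvfderiv_fun_sub mdifferentiableAt_const hmf, mvfderiv_const,
    mvfderiv_fun_mul hm hf]
  simp only [sub_apply, add_apply, smul_apply, zero_apply, smul_eq_mul, hV.mvfderiv_inner_self]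
  ring

theorem mvfderiv_lam_eq (ha : a ≠ 0) (hE : 2 ≤ Module.finrank ℝ E) (hE3 : Module.finrank ℝ E ≠ 3)
    (x : M) (u : TangentSpace I x) :
    mvfderiv I lam x u = 2 * a * mu x * inner ℝ (V x) u := by
  have hu : CMDiffAt ∞ (T% (extend E u)) x := contMDiffAt_extend I E u
  have h := hV.eq_zero_of_continuousAt (x := x)
    (g := fun y => mvfderiv I lam y (extend E u y)
      - 2 * a * mu y * inner ℝ (V y) (extend E u y)) ha (by omega)
    ((smoothAt_mvfderiv (hsol.smooth_lam x) hu).continuousAt.sub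
      ((continuousAt_const.mul (hsol.smooth_mu x).continuousAt).mul
        (smoothAt_inner (hV.smoothAt x) hu).continuousAt)) fun y hy => ?_
  · rw [extend_apply_self] at h
    linarith
  have hf : (inner ℝ (V y) (V y) : ℝ) ≠ 0 := inner_self_ne_zero.2 hy
  have hn3 : ((Module.finrank ℝ E : ℝ) - 3) ≠ 0 := by
    rw [sub_ne_zero]
    exact_mod_cast hE3
  have hn1 : ((Module.finrank ℝ E : ℝ) - 1) ≠ 0 := by
    rw [sub_ne_zero]
    exact_mod_cast (by omega : Module.finrank ℝ E ≠ 1)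
  have h1 := contracted_bianchi hV hsol y (V y)
  have h2 := mvfderiv_lam hV hsol ha (by omega) y (V y)
  have h3 := contracted_bianchi hV hsol y (extend E u y)
  have h4 := mvfderiv_lam hV hsol ha (by omega) y (extend E u y)
  -- In direction `V` the two relations involve only `dμ(V)`, with coefficient `(n - 1)|V|²`.
  have h5 : mvfderiv I mu y (V y) = -(4 * a * mu y) := by
    refine mul_left_cancel₀ (mul_ne_zero hn1 hf) ?_
    rw [h2] at h1
    linear_combination -h1
  rw [h5] at h3
  refine mul_left_cancel₀ hn3 ?_
  -- Subtraction eliminates `|V|² dμ(u)`; the coefficient of `aμη(u)` becomes `-8 + 2n + 2 = 2(n -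
  -- 3)`.
  linear_combination h3 - h4

theorem mvfderiv_mu (ha : a ≠ 0) (hE : 2 ≤ Module.finrank ℝ E) (hE3 : Module.finrank ℝ E ≠ 3)
    (x : M) (u : TangentSpace I x) :
    inner ℝ (V x) (V x) * mvfderiv I mu x u = -(4 * a * mu x) * inner ℝ (V x) u := by
  have h1 := mvfderiv_lam hV hsol ha (by omega) x u
  have h2 := mvfderiv_lam_eq hV hsol ha hE hE3 x u
  linarith

theorem mvfderiv_mu_self (ha : a ≠ 0) (hE : 2 ≤ Module.finrank ℝ E)
    (hE3 : Module.finrank ℝ E ≠ 3) (x : M) : mvfderiv I mu x (V x) = -(4 * a) * mu x := by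
  have h := hV.eq_zero_of_continuousAt (x := x)
    (g := fun y => mvfderiv I mu y (V y) + 4 * a * mu y) ha (by omega)
    ((smoothAt_mvfderiv (hsol.smooth_mu x) (hV.smoothAt x)).continuousAt.add
      (continuousAt_const.mul (hsol.smooth_mu x).continuousAt)) fun y hy => ?_
  · linarith
  have hf : (inner ℝ (V y) (V y) : ℝ) ≠ 0 := inner_self_ne_zero.2 hy
  refine mul_left_cancel₀ hf ?_
  linarith [mvfderiv_mu hV hsol ha hE hE3 y (V y)]

/-- The equation `Vμ = -4aμ` holds on all of `M`, so it may be differentiated at a zero of `V`.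
There `[u,V] = ∇_u V = a u`, and `[u,V]μ = u(Vμ) - V(uμ) = -4a dμ(u)`, so `5a dμ(u) = 0`. -/
theorem mvfderiv_mu_of_eq_zero (ha : a ≠ 0) (hE : 2 ≤ Module.finrank ℝ E)
    (hE3 : Module.finrank ℝ E ≠ 3) {x : M} (hx : V x = 0) (u : TangentSpace I x) :
    mvfderiv I mu x u = 0 := by
  have hu : CMDiffAt ∞ (T% (extend E u)) x := contMDiffAt_extend I E u
  have h := mvfderiv_mlieBracket (hsol.smooth_mu x) hu (hV.smoothAt x)
  have hev : (fun y => mvfderiv I mu y (V y)) = fun y => -(4 * a) * mu y := by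
    funext y
    exact mvfderiv_mu_self hV hsol ha hE hE3 y
  rw [hev, ← nabla_sub_nabla (mdiffAt_of_smoothAt hu) (mdiffAt_of_smoothAt (hV.smoothAt x)),
    hV.nabla_eq, hx, mvfderiv_fun_mul mdifferentiableAt_const
      ((hsol.smooth_mu x).mdifferentiableAt (by simp)), mvfderiv_const] at h
  simp only [nabla, hx, map_zero, sub_zero, Pi.smul_apply, extend_apply_self, map_smul, smul_zero,
    add_zero, smul_apply, smul_eq_mul] at h
  have h5 : (5 * a) * mvfderiv I mu x u = 0 := by linarith
  exact (mul_eq_zero.1 h5).resolve_left (by simpa using ha)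

theorem mvfderiv_scal (ha : a ≠ 0) (hE : 2 ≤ Module.finrank ℝ E) (hE3 : Module.finrank ℝ E ≠ 3)
    (x : M) (u : TangentSpace I x) :
    mvfderiv I (scal I) x u =
      2 * ((Module.finrank ℝ E : ℝ) - 1) * a * mu x * inner ℝ (V x) u := by
  -- The term `μ|V|²` of the scalar curvature equals `-(λ - a)`.
  have hs : (scal I : M → ℝ) = fun y => ((Module.finrank ℝ E : ℝ) - 1) * (lam y - a) := by
    rw [scal_eq hV hsol]
    funext y
    linarith [lam_sub hV hsol ha (by omega) y]
  have hl := (hsol.smooth_lam x).mdifferentiableAt (by simp)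
  have hla : MDiffAt (fun y => lam y - a) x := hl.sub mdifferentiableAt_const
  rw [hs, mvfderiv_fun_mul mdifferentiableAt_const hla,
    mvfderiv_const, mvfderiv_fun_sub hl mdifferentiableAt_const, mvfderiv_const]
  simp only [sub_zero, smul_zero, add_zero, smul_apply, smul_eq_mul,
    mvfderiv_lam_eq hV hsol ha hE hE3]
  ring

theorem isQuasiEinstein (hE : 3 ≤ Module.finrank ℝ E)
    (h0 : ∃ (x : M) (u v : TangentSpace I x), ric x u v ≠ 0) :
    IsQuasiEinstein (fun x => lam x - a) mu (flat V) where
  three_le_dim := hE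
  non_flat := by
    obtain ⟨x, u, v, h⟩ := h0
    by_contra! hR
    exact h (by simp [ric, hR])
  ric_ne_zero := h0
  smooth_alpha := hsol.smooth_lam.sub contMDiff_const
  smooth_beta := hsol.smooth_mu
  smooth_form := hsol.smooth_form
  ric_eq := ric_eq hV hsol

end

end IsAlmostEtaRicciSoliton

end RiemGeom

end

theorem mainTheorem4 (n : ℕ) {M : Type*} [TopologicalSpace M] [T2Space M]
    [ChartedSpace (EuclideanSpace ℝ (Fin n)) M] [IsManifold (𝓡 n) ∞ M]
    [RiemannianBundle (fun x : M => TangentSpace (𝓡 n) x)]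
    [IsContMDiffRiemannianBundle (𝓡 n) ∞ (EuclideanSpace ℝ (Fin n))
      (fun x : M => TangentSpace (𝓡 n) x)]
    (V : Π x : M, TangentSpace (𝓡 n) x) (lam mu : M → ℝ) (a : ℝ) (ha : a ≠ 0)
    (hV : RiemGeom.IsConcircular V (fun _ => a))
    (hsol : RiemGeom.IsAlmostEtaRicciSoliton V lam mu (RiemGeom.flat V)) :
    -- the quasi-Einstein equation
    (∀ (x : M) (u v : TangentSpace (𝓡 n) x),
      RiemGeom.ric x u v =
        (lam x - a) * inner ℝ u v + mu x * (RiemGeom.flat V x u * RiemGeom.flat V x v)) ∧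
    -- the manifold is quasi-Einstein, unless it is Ricci-flat
    (3 ≤ n → (∃ (x : M) (u v : TangentSpace (𝓡 n) x), RiemGeom.ric x u v ≠ 0) →
      RiemGeom.IsQuasiEinstein (fun x => lam x - a) mu (RiemGeom.flat V)) ∧
    -- the scalar curvature is smooth, so that its gradient makes sense
    ContMDiff (𝓡 n) 𝓘(ℝ, ℝ) ∞ (RiemGeom.scal (M := M) (𝓡 n)) ∧
    -- the three gradients are collinear with the potential
    (n ≠ 3 →
      RiemGeom.AreCollinear (RiemGeom.grad (𝓡 n) lam) V ∧
      RiemGeom.AreCollinear (RiemGeom.grad (𝓡 n) mu) V ∧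
      RiemGeom.AreCollinear (RiemGeom.grad (𝓡 n) (RiemGeom.scal (M := M) (𝓡 n))) V) ∧
    -- the explicit coefficients
    (2 ≤ n → n ≠ 3 → ∀ x : M,
      RiemGeom.grad (𝓡 n) lam x = (2 * a * mu x) • V x ∧
      (V x ≠ 0 → RiemGeom.grad (𝓡 n) mu x = (-(4 * a * mu x) / inner ℝ (V x) (V x)) • V x) ∧
      (V x = 0 → RiemGeom.grad (𝓡 n) mu x = 0) ∧
      RiemGeom.grad (𝓡 n) (RiemGeom.scal (M := M) (𝓡 n)) x =
        (2 * (n - 1 : ℝ) * a * mu x) • V x) := by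
  have hn : Module.finrank ℝ (EuclideanSpace ℝ (Fin n)) = n := by simp
  have hex : 2 ≤ n → n ≠ 3 → ∀ x : M,
      RiemGeom.grad (𝓡 n) lam x = (2 * a * mu x) • V x ∧
      (V x ≠ 0 → RiemGeom.grad (𝓡 n) mu x = (-(4 * a * mu x) / inner ℝ (V x) (V x)) • V x) ∧
      (V x = 0 → RiemGeom.grad (𝓡 n) mu x = 0) ∧
      RiemGeom.grad (𝓡 n) (RiemGeom.scal (M := M) (𝓡 n)) x =
        (2 * (n - 1 : ℝ) * a * mu x) • V x := by
    intro h2 h3 x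
    rw [← hn] at h2 h3
    refine ⟨RiemGeom.grad_eq_iff.2 fun u => ?_, fun hx => RiemGeom.grad_eq_iff.2 fun u => ?_,
      fun hx => RiemGeom.grad_eq_iff.2 fun u => ?_, RiemGeom.grad_eq_iff.2 fun u => ?_⟩
    · rw [real_inner_smul_left]
      exact hsol.mvfderiv_lam_eq hV ha h2 h3 x u
    · have hf : (inner ℝ (V x) (V x) : ℝ) ≠ 0 := inner_self_ne_zero.2 hx
      have h := hsol.mvfderiv_mu hV ha h2 h3 x u
      rw [real_inner_smul_left, div_mul_eq_mul_div, eq_div_iff hf, ← h, mul_comm]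
    · rw [inner_zero_left]
      exact hsol.mvfderiv_mu_of_eq_zero hV ha h2 h3 hx u
    · rw [real_inner_smul_left, hsol.mvfderiv_scal hV ha h2 h3, hn]
  refine ⟨hsol.ric_eq hV, fun h3 h0 => hsol.isQuasiEinstein hV (by rwa [hn]) h0,
    hsol.smooth_scal hV, fun h3 => ?_, hex⟩
  -- For `n ≤ 1` the coefficient formulas are not available, but any two vectors of a tangent space
  -- are dependent.
  rcases Nat.lt_or_ge n 2 with h2 | h2
  · have h1 : Module.finrank ℝ (EuclideanSpace ℝ (Fin n)) ≤ 1 := by omega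
    exact ⟨RiemGeom.areCollinear_of_finrank_le_one h1 _ _,
      RiemGeom.areCollinear_of_finrank_le_one h1 _ _,
      RiemGeom.areCollinear_of_finrank_le_one h1 _ _⟩
  · exact ⟨RiemGeom.areCollinear_of_forall_smul fun x _ => ⟨_, (hex h2 h3 x).1⟩,
      RiemGeom.areCollinear_of_forall_smul fun x hx => ⟨_, (hex h2 h3 x).2.1 hx⟩,
      RiemGeom.areCollinear_of_forall_smul fun x _ => ⟨_, (hex h2 h3 x).2.2.2⟩⟩
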